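/- **Theorem (from discrete signatures to the binary signature).** A signature $\Sigma=(\mathcal F;\mathcal P)$ consists of a type $\mathcal F$ of function symbols and a type $\mathcal P$ of relation symbols, each symbol having an arity in $\mathbb N$. First-order formulas over $\Sigma$ are built from $\bot$ and atoms $P\,\vec t$ with $\to,\land,\lor,\forall,\exists$; equality is not a logical symbol. $\mathrm{FSAT}(\Sigma)\,\varphi$ means that there are a finite domain $D$, an interpretation of $\Sigma$ over $D$ with decidable relations, and an assignment $\rho:\mathbb N\to D$ under which $\varphi$ is satisfied. Computability refers to codes: a coding of a type $X$ is a relation "the number $n$ is a code of $x\in X$". Elements may have several codes, and elements without a code are allowed. A function $f:X\to Y$ between coded types is computable if some partial recursive function sends every code of every $x\in X$ to a code of $f(x)$. A coded type is discrete if some partial recursive function, given any code of $x$ and any code of $y$, halts and decides whether $x=y$. Formulas over $\Sigma$ are coded as finite labelled trees, using the given codes of the symbols. The formulas over $(\emptyset;\{P^2\})$, the signature without function symbols whose only relation symbol $P$ is binary, are coded in the same way, with $P$ coded by $0$. Let $\Sigma$ be a discrete signature, that is, let $\mathcal F$ and $\mathcal P$ be equipped with codings that make them discrete. Then $\mathrm{FSAT}(\Sigma)$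 many-one reduces to $\mathrm{FSAT}(\emptyset;\{P^2\})$: there is a computable function $f$ from formulas over $\Sigma$ to formulas over $(\emptyset;\{P^2\})$ such that, for every formula $\varphi$ over $\Sigma$, $$\mathrm{FSAT}(\Sigma)\,\varphi\iff \mathrm{FSAT}(\emptyset;\{P^2\})\,(f(\varphi)).$$ -/

import Mathlib

universe u v

namespace FinSat

/-! ### Syntax and semantics of first-order logic (no built-in equality) -/

/-- A first-order signature: types of function and relation symbols, each symbol with an arity. -/
structure Signature where
  Fun : Type u
  Rel : Type v
  funArity : Fun → ℕ
  relArity : Rel → ℕ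

/-- Terms over `S`; variables are de Bruijn indices. -/
inductive Term (S : Signature.{u, v}) : Type u
  | var (x : ℕ) : Term S
  | app (f : S.Fun) (ts : Fin (S.funArity f) → Term S) : Term S

/-- Formulas over `S`; `all` and `ex` bind the de Bruijn index `0`. -/
inductive Form (S : Signature.{u, v}) : Type (max u v)
  | bot : Form S
  | rel (P : S.Rel) (ts : Fin (S.relArity P) → Term S) : Form S
  | imp (φ ψ : Form S) : Form S
  | and (φ ψ : Form S) : Form S
  | or (φ ψ : Form S) : Form S
  | all (φ : Form S) : Form S
  | ex (φ : Form S) : Form S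

/-- An interpretation of the symbols of `S` over the domain `D`. -/
structure Model (S : Signature.{u, v}) (D : Type) where
  funInt : (f : S.Fun) → (Fin (S.funArity f) → D) → D
  relInt : (P : S.Rel) → (Fin (S.relArity P) → D) → Prop

/-- Every relation of the model is decided by a Boolean function. -/
def Model.IsDecidable {S : Signature.{u, v}} {D : Type} (M : Model S D) : Prop :=
  ∀ P : S.Rel, ∃ b : (Fin (S.relArity P) → D) → Bool, ∀ w, M.relInt P w ↔ b w = true

/-- The assignment `a · ρ`: `0` is sent to `a`, and `n + 1` to `ρ n`. -/
def scons {D : Type} (a : D) (ρ : ℕ → D) : ℕ → D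
  | 0 => a
  | n + 1 => ρ n

/-- Evaluation of terms. -/
def Term.eval {S : Signature.{u, v}} {D : Type} (M : Model S D) (ρ : ℕ → D) : Term S → D
  | .var x => ρ x
  | .app f ts => M.funInt f fun i => (ts i).eval M ρ

/-- Tarski satisfaction. -/
def Form.Sat {S : Signature.{u, v}} {D : Type} (M : Model S D) : (ℕ → D) → Form S → Prop
  | _, .bot => False
  | ρ, .rel P ts => M.relInt P fun i => (ts i).eval M ρ
  | ρ, .imp φ ψ => φ.Sat M ρ → ψ.Sat M ρ
  | ρ, .and φ ψ => φ.Sat M ρ ∧ ψ.Sat M ρ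
  | ρ, .or φ ψ => φ.Sat M ρ ∨ ψ.Sat M ρ
  | ρ, .all φ => ∀ a : D, φ.Sat M (scons a ρ)
  | ρ, .ex φ => ∃ a : D, φ.Sat M (scons a ρ)

/-- Finite satisfiability: some finite decidable model, under some assignment, satisfies `φ`.
(As every finite type is in bijection with some `Fin n`, domains in `Type` suffice.) -/
def FSAT (S : Signature.{u, v}) (φ : Form S) : Prop :=
  ∃ (D : Type) (M : Model S D) (ρ : ℕ → D), Finite D ∧ M.IsDecidable ∧ φ.Sat M ρ

/-- The signature without function symbols and with a single relation symbol, of arity two. -/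
def binarySignature : Signature.{0, 0} where
  Fun := Empty
  Rel := Unit
  funArity := Empty.elim
  relArity := fun _ => 2

/-! ### Computability on coded types

An algorithm handles the elements of a type through natural numbers coding them. An element may
have several codes. Elements without a code are not excluded, so that a signature may have
uncountably many symbols: an algorithm has to be correct on every code of every coded element. -/

/-- `c n x` is read as: the number `n` is a code of `x`. -/
abbrev Coding (X : Type u) := ℕ → X → Prop

/-- The function `f` is computable: a partial recursive function maps each code of each `x` to a
code of `f x`. -/
def ComputableFun {X : Type u} {Y : Type v} (c : Coding X) (d : Coding Y) (f : X → Y) : Prop :=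
  ∃ g : ℕ →. ℕ, Partrec g ∧ ∀ n x, c n x → ∃ m ∈ g n, d m (f x)

/-- Equality is decidable: a partial recursive test, applied to codes of `x` and of `y`, halts and
tells whether `x = y`. -/
def Discrete {X : Type u} (c : Coding X) : Prop :=
  ∃ e : ℕ × ℕ →. Bool, Partrec e ∧
    ∀ m n x y, c m x → c n y → ∃ b ∈ e (m, n), b = true ↔ x = y

/-- Many-one reducibility of `p` to `q`, by a computable function. -/
def Reduces {X : Type u} {Y : Type v} (c : Coding X) (d : Coding Y)
    (p : X → Prop) (q : Y → Prop) : Prop :=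
  ∃ f : X → Y, ComputableFun c d f ∧ ∀ x, p x ↔ q (f x)

/-- The coding of terms as labelled trees that a coding of the function symbols induces. A compound
term is coded by a code of its head symbol and the list of codes of its arguments. -/
inductive Term.coding {S : Signature.{u, v}} (cF : Coding S.Fun) : Coding (Term S)
  | var (x : ℕ) : Term.coding cF (Nat.pair 0 x) (.var x)
  | app (k : ℕ) (f : S.Fun) (ns : Fin (S.funArity f) → ℕ) (ts : Fin (S.funArity f) → Term S) :
      cF k f → (∀ i, Term.coding cF (ns i) (ts i)) →
      Term.coding cF (Nat.pair 1 (Nat.pair k (Encodable.encode (List.ofFn ns)))) (.app f ts)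

/-- The coding of formulas as labelled trees that codings of the symbols induce. -/
inductive Form.coding {S : Signature.{u, v}} (cF : Coding S.Fun) (cR : Coding S.Rel) :
    Coding (Form S)
  | bot : Form.coding cF cR (Nat.pair 0 0) .bot
  | rel (k : ℕ) (P : S.Rel) (ns : Fin (S.relArity P) → ℕ) (ts : Fin (S.relArity P) → Term S) :
      cR k P → (∀ i, Term.coding cF (ns i) (ts i)) →
      Form.coding cF cR (Nat.pair 1 (Nat.pair k (Encodable.encode (List.ofFn ns)))) (.rel P ts)
  | imp (m n : ℕ) (φ ψ : Form S) : Form.coding cF cR m φ → Form.coding cF cR n ψ →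
      Form.coding cF cR (Nat.pair 2 (Nat.pair m n)) (.imp φ ψ)
  | and (m n : ℕ) (φ ψ : Form S) : Form.coding cF cR m φ → Form.coding cF cR n ψ →
      Form.coding cF cR (Nat.pair 3 (Nat.pair m n)) (.and φ ψ)
  | or (m n : ℕ) (φ ψ : Form S) : Form.coding cF cR m φ → Form.coding cF cR n ψ →
      Form.coding cF cR (Nat.pair 4 (Nat.pair m n)) (.or φ ψ)
  | all (n : ℕ) (φ : Form S) : Form.coding cF cR n φ → Form.coding cF cR (Nat.pair 5 n) (.all φ)
  | ex (n : ℕ) (φ : Form S) : Form.coding cF cR n φ → Form.coding cF cR (Nat.pair 6 n) (.ex φ)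

/-- The formulas over the binary signature, its only symbol being coded by `0`. -/
def binaryFormCoding : Coding (Form binarySignature) :=
  Form.coding (S := binarySignature) (fun _ _ => False) (fun n _ => n = 0)

end FinSat

/-!
A formula over `S` is first read in a structure with a single binary operation, *application*:
the term `f t₁ … tₖ` becomes `c_f · t₁ ⋯ tₖ` and the atom `P t₁ … tₖ` becomes the statement that the
point `c_P · t₁ ⋯ tₖ` is marked, where the points `c_f` and `c_P` are values of free variables.
Application and marking are given by fixed formulas over one binary relation `R`: a point `v`
extends `w` by `a` (`Ext`) if `R w v` holds, `w` and `v` have no loops, and `R a y` and `R y v` hold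
for some point `y` with a loop; the result of applying `w` to `a` (`step`) is the only such `v`, and `w`
if there is none or more than one. Equality, which this description uses, is expressed as
indiscernibility with respect to `R`.

If a finite binary model satisfies the translation, its quotient by indiscernibility does so too
(`exists_separated`), and there iterated application interprets the symbols (`spineModel`) in such
a way that the formula and its translation mean the same (`Form.sat_tr`). Application being total by
definition, this requires no axioms. Conversely, a finite model `D` of the formula yields a binary
model whose points are the elements of `D` and the partial applications of the symbols, arranged in
trees (`Pt`). All points count as elements: each represents an element of `D`, and the map
`Pt.proj` from points to elements is surjective and respects the symbols of the formula, which is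
enough to preserve satisfaction in the absence of equality (`Form.sat_map`). Hence neither
relativized quantifiers nor conditions on free variables are needed.

The free variable for a symbol is found from the position of its first occurrence in the formula, so
the result does not depend on the codes of symbols, and equality tests on codes suffice to compute
it. The recursions on codes are justified by Kleene's second recursion theorem
(`exists_fixedPoint`); their correctness is an induction on the coding relation.
-/

namespace FinSat

/-! ### Symbols of a formula and strict homomorphisms -/

/-- The function and relation symbols of a signature, taken together. -/
abbrev Sym (S : Signature.{u, v}) := S.Fun ⊕ S.Rel

/-- The occurrences of symbols in a term, in prefix order. -/
def Term.syms {S : Signature.{u, v}} : Term S → List (Sym S)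
  | .var _ => []
  | .app f ts => .inl f :: (List.ofFn fun i => (ts i).syms).flatten

/-- The occurrences of symbols in a formula, in prefix order. -/
def Form.syms {S : Signature.{u, v}} : Form S → List (Sym S)
  | .bot => []
  | .rel P ts => .inr P :: (List.ofFn fun i => (ts i).syms).flatten
  | .imp φ ψ => φ.syms ++ ψ.syms
  | .and φ ψ => φ.syms ++ ψ.syms
  | .or φ ψ => φ.syms ++ ψ.syms
  | .all φ => φ.syms
  | .ex φ => φ.syms

theorem comp_scons {A D : Type} (π : A → D) (a : A) (ρ : ℕ → A) :
    π ∘ scons a ρ = scons (π a) (π ∘ ρ) := by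
  funext n; cases n <;> rfl

section Hom

variable {S : Signature.{u, v}} {A D : Type} {M : Model S A} {N : Model S D} {π : A → D}
  {L : List (Sym S)}

theorem Term.eval_map
    (hF : ∀ f, .inl f ∈ L → ∀ x, π (M.funInt f x) = N.funInt f (π ∘ x))
    (ρ : ℕ → A) (t : Term S) (ht : t.syms ⊆ L) : π (t.eval M ρ) = t.eval N (π ∘ ρ) := by
  induction t with
  | var x => rfl
  | app f ts ih =>
    simp only [Term.syms, List.cons_subset] at ht
    simp only [Term.eval]
    rw [hF f ht.1]
    congr 1
    funext i
    refine ih i fun s hs => ht.2 ?_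
    exact List.mem_flatten.2 ⟨_, (List.mem_ofFn' _ _).2 ⟨i, rfl⟩, hs⟩

/-- In the absence of equality, a surjection that respects the symbols of a formula preserves
and reflects its satisfaction, whether or not it is injective. -/
theorem Form.sat_map (hπ : Function.Surjective π)
    (hF : ∀ f, .inl f ∈ L → ∀ x, π (M.funInt f x) = N.funInt f (π ∘ x))
    (hR : ∀ P, .inr P ∈ L → ∀ x, M.relInt P x ↔ N.relInt P (π ∘ x))
    (φ : Form S) (hφ : φ.syms ⊆ L) (ρ : ℕ → A) : φ.Sat M ρ ↔ φ.Sat N (π ∘ ρ) := by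
  induction φ generalizing ρ with
  | bot => rfl
  | rel P ts =>
    simp only [Form.syms, List.cons_subset] at hφ
    simp only [Form.Sat]
    rw [hR P hφ.1]
    have : (π ∘ fun i => (ts i).eval M ρ) = fun i => (ts i).eval N (π ∘ ρ) := by
      funext i
      refine Term.eval_map hF ρ _ fun s hs => hφ.2 ?_
      exact List.mem_flatten.2 ⟨_, (List.mem_ofFn' _ _).2 ⟨i, rfl⟩, hs⟩
    rw [this]
  | imp φ ψ ih₁ ih₂ | and φ ψ ih₁ ih₂ | or φ ψ ih₁ ih₂ =>
    simp only [Form.syms, List.append_subset] at hφ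
    simp only [Form.Sat, ih₁ hφ.1, ih₂ hφ.2]
  | all φ ih =>
    simp only [Form.Sat, ih hφ, comp_scons]
    exact (hπ.forall (p := fun d => φ.Sat N (scons d (π ∘ ρ)))).symm
  | ex φ ih =>
    simp only [Form.Sat, ih hφ, comp_scons]
    exact (hπ.exists (p := fun d => φ.Sat N (scons d (π ∘ ρ)))).symm

end Hom

/-! ### Models with one binary relation -/

/-- Formulas over the binary signature. -/
abbrev BForm := Form binarySignature

/-- The model of the binary signature given by a binary relation. -/
def relModel {A : Type} (R : A → A → Prop) : Model binarySignature A where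
  funInt := fun f => f.elim
  relInt := fun _ w => R (w (0 : Fin 2)) (w (1 : Fin 2))

/-- Two points that no instance of `R` tells apart. -/
def Indisc {A : Type} (R : A → A → Prop) (x y : A) : Prop :=
  ∀ z, (R z x ↔ R z y) ∧ (R x z ↔ R y z)

/-- Indiscernible points are equal. -/
def Separated {A : Type} (R : A → A → Prop) : Prop := ∀ x y, Indisc R x y → x = y

theorem exists_relModel {A : Type} (M : Model binarySignature A) : ∃ R, M = relModel R := by
  obtain ⟨F, I⟩ := M
  refine ⟨fun a b => I () (fun i : Fin 2 => if i = 0 then a else b), ?_⟩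
  unfold relModel
  congr 1
  · funext f; exact f.elim
  · funext _ w
    congr 1
    funext (i : Fin 2)
    fin_cases i <;> rfl

theorem Model.isDecidable {S : Signature.{u, v}} {A : Type} (M : Model S A) : M.IsDecidable := by
  classical
  exact fun P => ⟨fun w => decide (M.relInt P w), fun w => by simp⟩

/-- Indiscernibility, as an equivalence relation. -/
def indiscSetoid {A : Type} (R : A → A → Prop) : Setoid A where
  r := Indisc R
  iseqv :=
    ⟨fun _ _ => ⟨Iff.rfl, Iff.rfl⟩, fun h z => ⟨(h z).1.symm, (h z).2.symm⟩,
      fun h k z => ⟨(h z).1.trans (k z).1, (h z).2.trans (k z).2⟩⟩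

/-- Every binary model has a separated quotient that satisfies the same formulas. -/
theorem exists_separated {A : Type} [Finite A] (R : A → A → Prop) (ρ : ℕ → A) :
    ∃ (Q : Type) (R' : Q → Q → Prop) (ρ' : ℕ → Q), Finite Q ∧ Separated R' ∧
      ∀ φ : BForm, φ.Sat (relModel R) ρ ↔ φ.Sat (relModel R') ρ' := by
  let s := indiscSetoid R
  let R' : Quotient s → Quotient s → Prop := fun p q => R p.out q.out
  have out (a : A) : Indisc R (⟦a⟧ : Quotient s).out a := Quotient.mk_out a
  have key (a b : A) : R a b ↔ R' ⟦a⟧ ⟦b⟧ :=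
    (((out a b).2).symm).trans (((out b _).1).symm)
  refine ⟨Quotient s, R', fun n => ⟦ρ n⟧, inferInstance, ?_, fun φ => ?_⟩
  · intro x y
    refine Quotient.inductionOn₂ x y fun a b h => Quotient.sound fun z => ?_
    simpa only [key] using h ⟦z⟧
  · refine Form.sat_map (L := φ.syms) (π := Quotient.mk s) Quotient.mk_surjective ?_ ?_ φ
      (fun _ h => h) ρ
    · exact fun f => f.elim
    · exact fun _ _ x => key _ _

/-! ### Definable application in a binary model -/

section Application

variable {A : Type} (R : A → A → Prop)

/-- The point `v` is an extension of `w` by `a`. Points with a loop act as labels; the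
point `a` has to carry a label that `v` has as well. -/
def Ext (w a v : A) : Prop := R w v ∧ ¬ R w w ∧ ¬ R v v ∧ ∃ y, R y y ∧ R a y ∧ R y v

open Classical in
/-- The result of applying `w` to `a`: the unique extension of `w` by `a`, and `w` if there is
not exactly one. -/
noncomputable def step (w a : A) : A := if h : ∃! v, Ext R w a v then h.choose else w

/-- The truth value attached to a point. -/
def Mark (v : A) : Prop := ∃ y, R v y ∧ ¬ R y y

theorem step_eq_of_unique {w a v : A} (h : Ext R w a v) (hu : ∀ v', Ext R w a v' → v' = v) :
    step R w a = v := by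
  have h' : ∃! v, Ext R w a v := ⟨v, h, hu⟩
  rw [step, dif_pos h']
  exact hu _ h'.choose_spec.1

theorem eq_step_iff (w a v : A) :
    v = step R w a ↔ (Ext R w a v ∧ ∀ v', Ext R w a v' → v' = v) ∨
      (w = v ∧ ¬ ∃ v, Ext R w a v ∧ ∀ v', Ext R w a v' → v' = v) := by
  by_cases h : ∃! v, Ext R w a v
  · obtain ⟨u, hu, hu'⟩ := h
    rw [step_eq_of_unique R hu hu']
    constructor
    · rintro rfl
      exact .inl ⟨hu, hu'⟩
    · rintro (h | ⟨_, h⟩)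
      · exact hu' _ h.1
      · exact absurd ⟨u, hu, hu'⟩ h
  · rw [step, dif_neg h]
    constructor
    · rintro rfl
      exact .inr ⟨rfl, h⟩
    · rintro (h' | ⟨h', _⟩)
      · exact absurd ⟨v, h'⟩ h
      · exact h'.symm

/-- The atom `P x y` of the binary signature. -/
def edgeF (x y : ℕ) : BForm := .rel () (fun i : Fin 2 => .var (if i = 0 then x else y))

/-- Negation. -/
def notF (φ : BForm) : BForm := .imp φ .bot

/-- Equivalence. -/
def iffF (φ ψ : BForm) : BForm := .and (.imp φ ψ) (.imp ψ φ)

/-- The formula expressing `Indisc`. -/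
def eqF (x y : ℕ) : BForm :=
  .all (.and (iffF (edgeF 0 (x + 1)) (edgeF 0 (y + 1))) (iffF (edgeF (x + 1) 0) (edgeF (y + 1) 0)))

/-- The formula expressing `Ext`. -/
def extF (w a v : ℕ) : BForm :=
  .and (edgeF w v) (.and (notF (edgeF w w)) (.and (notF (edgeF v v))
    (.ex (.and (edgeF 0 0) (.and (edgeF (a + 1) 0) (edgeF 0 (v + 1)))))))

/-- The formula saying that `v` is the only extension of `w` by `a`. -/
def uniqueExtF (w a v : ℕ) : BForm :=
  .and (extF w a v) (.all (.imp (extF (w + 1) (a + 1) 0) (eqF 0 (v + 1))))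

/-- The formula saying that `v` is the result of applying `w` to `a`. -/
def stepF (w a v : ℕ) : BForm :=
  .or (uniqueExtF w a v) (.and (eqF w v) (notF (.ex (uniqueExtF (w + 1) (a + 1) 0))))

/-- The formula expressing `Mark`. -/
def markF (v : ℕ) : BForm := .ex (.and (edgeF (v + 1) 0) (notF (edgeF 0 0)))

variable {R}

@[simp] theorem sat_edgeF (ρ : ℕ → A) (x y : ℕ) :
    (edgeF x y).Sat (relModel R) ρ ↔ R (ρ x) (ρ y) := Iff.rfl

@[simp] theorem sat_eqF (hR : Separated R) (ρ : ℕ → A) (x y : ℕ) :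
    (eqF x y).Sat (relModel R) ρ ↔ ρ x = ρ y := by
  constructor
  · exact fun h => hR _ _ fun z => ⟨⟨(h z).1.1, (h z).1.2⟩, ⟨(h z).2.1, (h z).2.2⟩⟩
  · intro h
    simp [eqF, iffF, Form.Sat, scons, h]

@[simp] theorem sat_extF (ρ : ℕ → A) (w a v : ℕ) :
    (extF w a v).Sat (relModel R) ρ ↔ Ext R (ρ w) (ρ a) (ρ v) := Iff.rfl

theorem sat_uniqueExtF (hR : Separated R) (ρ : ℕ → A) (w a v : ℕ) :
    (uniqueExtF w a v).Sat (relModel R) ρ ↔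
      Ext R (ρ w) (ρ a) (ρ v) ∧ ∀ v', Ext R (ρ w) (ρ a) v' → v' = ρ v := by
  simp [uniqueExtF, Form.Sat, hR, scons]

theorem sat_stepF (hR : Separated R) (ρ : ℕ → A) (w a v : ℕ) :
    (stepF w a v).Sat (relModel R) ρ ↔ ρ v = step R (ρ w) (ρ a) := by
  rw [eq_step_iff]
  simp only [stepF, notF, Form.Sat, sat_uniqueExtF hR, sat_eqF hR, scons]

theorem sat_markF (ρ : ℕ → A) (v : ℕ) : (markF v).Sat (relModel R) ρ ↔ Mark R (ρ v) := Iff.rfl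

end Application

/-! ### The translation -/

/-- The formula saying that `v` is the result of applying `w` successively to the values described
by the list `Ts`. An element `T` of `Ts` describes a value: `T r v` says that `v` is this value,
`r` being the number of quantifiers passed since the start of the atom. -/
def spineF : List (ℕ → ℕ → BForm) → ℕ → ℕ → ℕ → BForm
  | [], _, w, v => eqF w v
  | T :: Ts, r, w, v =>
    .ex (.ex (.and (T (r + 2) 1) (.and (stepF (w + 2) 1 0) (spineF Ts (r + 2) 0 (v + 2)))))

section Translation

variable {S : Signature.{u, v}} (ix : Sym S → ℕ)

/-- The formula saying that the variable `v` is the value of a term. The variable `x` of the term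
is represented by the variable `2 * x`, and the symbol `s` by the variable `2 * (ix s + d) + 1`,
`d` being the number of quantifiers above the atom; both are shifted by `r`. -/
def Term.tr (d : ℕ) : Term S → ℕ → ℕ → BForm
  | .var x, r, v => eqF (2 * x + r) v
  | .app f ts, r, v =>
    spineF (List.ofFn fun i => (ts i).tr d) r (2 * (ix (.inl f) + d) + 1 + r) v

/-- The translation of formulas. An atom `P t₁ … tₖ` says that the point obtained by applying the
point that represents `P` to the values of `t₁, …, tₖ` is marked. Every quantifier is
preceded by an idle one, so that the variables of odd index remain available for the symbols. -/
def Form.tr : ℕ → Form S → BForm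
  | _, .bot => .bot
  | d, .rel P ts =>
    .ex (.and (spineF (List.ofFn fun i => (ts i).tr ix d) 1 (2 * (ix (.inr P) + d) + 1 + 1) 0)
      (markF 0))
  | d, .imp φ ψ => .imp (φ.tr d) (ψ.tr d)
  | d, .and φ ψ => .and (φ.tr d) (ψ.tr d)
  | d, .or φ ψ => .or (φ.tr d) (ψ.tr d)
  | d, .all φ => .all (.all (φ.tr (d + 1)))
  | d, .ex φ => .ex (.ex (φ.tr (d + 1)))

/-- The model of `S` that a binary relation induces, once a point is chosen for every symbol:
symbols are interpreted by iterated application. -/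
noncomputable def spineModel {A : Type} (R : A → A → Prop) (C : Sym S → A) : Model S A where
  funInt := fun f x => (List.ofFn x).foldl (step R) (C (.inl f))
  relInt := fun P x => Mark R ((List.ofFn x).foldl (step R) (C (.inr P)))

variable {A : Type} {R : A → A → Prop}

theorem sat_spineF (hR : Separated R) (Good : (ℕ → A) → ℕ → Prop)
    (hG : ∀ ρ r a b, Good ρ r → Good (scons b (scons a ρ)) (r + 2))
    {Ts : List (ℕ → ℕ → BForm)} {as : List A}
    (h : List.Forall₂
      (fun T a => ∀ ρ r v, Good ρ r → ((T r v).Sat (relModel R) ρ ↔ ρ v = a)) Ts as)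
    (ρ : ℕ → A) (r w v : ℕ) (hρ : Good ρ r) :
    (spineF Ts r w v).Sat (relModel R) ρ ↔ ρ v = as.foldl (step R) (ρ w) := by
  induction h generalizing ρ r w v with
  | nil => simp [spineF, hR, eq_comm]
  | cons hT _ ih =>
    simp only [spineF, Form.Sat, sat_stepF hR, List.foldl_cons]
    have h₁ (a b : A) := hT (scons b (scons a ρ)) (r + 2) 1 (hG _ _ a b hρ)
    have h₂ (a b : A) := ih (scons b (scons a ρ)) (r + 2) 0 (v + 2) (hG _ _ a b hρ)
    simp only [h₁, h₂]
    simp [scons]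

variable {ix}

theorem Term.sat_tr (hR : Separated R) {d : ℕ} {C : Sym S → A} {ρ₀ : ℕ → A} (t : Term S)
    (ρ : ℕ → A) (r v : ℕ) (hv : ∀ x, ρ (2 * x + r) = ρ₀ x)
    (hs : ∀ s, ρ (2 * (ix s + d) + 1 + r) = C s) :
    (t.tr ix d r v).Sat (relModel R) ρ ↔ ρ v = t.eval (spineModel R C) ρ₀ := by
  induction t generalizing ρ r v with
  | var x => simp [Term.tr, Term.eval, hR, hv, eq_comm]
  | app f ts ih =>
    rw [Term.tr, sat_spineF (as := List.ofFn fun i => (ts i).eval (spineModel R C) ρ₀) hR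
      (fun ρ r => (∀ x, ρ (2 * x + r) = ρ₀ x) ∧ ∀ s, ρ (2 * (ix s + d) + 1 + r) = C s), hs]
    · rfl
    · exact fun _ _ _ _ h => h
    · rw [List.forall₂_iff_get]
      refine ⟨by simp, fun i h₁ h₂ ρ r v h => ?_⟩
      simpa using ih _ ρ r v h.1 h.2
    · exact ⟨hv, hs⟩

/-- In a separated binary model, the translation of a formula says what the formula says in the
induced model of `S`. No axioms about the binary relation are required, since `step` is total by
definition. -/
theorem Form.sat_tr (hR : Separated R) {C : Sym S → A} (φ : Form S) (d : ℕ)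
    (ρ ρ₀ : ℕ → A) (hv : ∀ x, ρ (2 * x) = ρ₀ x) (hs : ∀ s, ρ (2 * (ix s + d) + 1) = C s) :
    (φ.tr ix d).Sat (relModel R) ρ ↔ φ.Sat (spineModel R C) ρ₀ := by
  have hv' (a b : A) {ρ ρ₀ : ℕ → A} (hv : ∀ x, ρ (2 * x) = ρ₀ x) (x : ℕ) :
      scons a (scons b ρ) (2 * x) = scons a ρ₀ x := by
    cases x with
    | zero => rfl
    | succ x => exact hv x
  induction φ generalizing d ρ ρ₀ with
  | bot => rfl
  | rel P ts =>
    have key (a : A) := sat_spineF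
      (as := List.ofFn fun i => (ts i).eval (spineModel R C) ρ₀)
      (Ts := List.ofFn fun i => (ts i).tr ix d) hR
      (fun ρ r => (∀ x, ρ (2 * x + r) = ρ₀ x) ∧ ∀ s, ρ (2 * (ix s + d) + 1 + r) = C s)
      (fun _ _ _ _ h => h) (by
        rw [List.forall₂_iff_get]
        refine ⟨by simp, fun i h₁ h₂ ρ r v h => ?_⟩
        simpa using Term.sat_tr hR _ ρ r v h.1 h.2)
      (scons a ρ) 1 (2 * (ix (.inr P) + d) + 1 + 1) 0 ⟨hv, hs⟩
    simp only [Form.tr, Form.Sat, key, sat_markF]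
    simp [scons, hs, spineModel]
  | imp φ ψ ih₁ ih₂ | and φ ψ ih₁ ih₂ | or φ ψ ih₁ ih₂ =>
    simp only [Form.tr, Form.Sat, ih₁ d ρ ρ₀ hv hs, ih₂ d ρ ρ₀ hv hs]
  -- The idle quantifier is harmless because `a` itself can serve as its value.
  | all φ ih =>
    have key (a b : A) := ih (d + 1) (scons a (scons b ρ)) (scons a ρ₀) (hv' a b hv) hs
    simp only [Form.tr, Form.Sat, key]
    exact ⟨fun h a => h a a, fun h _ a => h a⟩
  | ex φ ih =>
    have key (a b : A) := ih (d + 1) (scons a (scons b ρ)) (scons a ρ₀) (hv' a b hv) hs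
    simp only [Form.tr, Form.Sat, key]
    exact ⟨fun ⟨_, a, h⟩ => ⟨a, h⟩, fun ⟨a, h⟩ => ⟨a, a, h⟩⟩

/-- A finitely satisfiable translation comes from a finitely satisfiable formula, for any
numbering of the symbols. -/
theorem fsat_of_fsat_tr (φ : Form S) (h : FSAT binarySignature (φ.tr ix 0)) : FSAT S φ := by
  obtain ⟨A, M, ρ, _, -, hφ⟩ := h
  obtain ⟨R, rfl⟩ := exists_relModel M
  obtain ⟨Q, R', ρ', hQ, hR', h⟩ := exists_separated R ρ
  exact ⟨Q, spineModel R' fun s => ρ' (2 * (ix s + 0) + 1), fun x => ρ' (2 * x), hQ,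
    Model.isDecidable _, (Form.sat_tr hR' φ 0 ρ' _ (fun _ => rfl) fun _ => rfl).1 ((h _).1 hφ)⟩

end Translation

/-! ### The tree of partial applications -/

/-- Points of the binary model built from a domain `D`: its elements, and for each symbol (given by
a number) a name and the nodes of a tree, which stand for the partial applications of the symbol. -/
inductive Pt (D : Type) : Type
  | elem (d : D)
  | name (i : ℕ)
  | node (i : ℕ) (l : List D)

namespace Pt

variable {D : Type} (val : ℕ → List D → D) (tt : ℕ → List D → Prop)

/-- The element of `D` that a point represents; that of a name is irrelevant. -/
def proj : Pt D → D
  | elem d => d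
  | name i => val i []
  | node i l => val i l

/-- The binary relation on points. Elements have a loop and are pointed at by the points that they
represent; a node is pointed at by the last entry of its list, by its parent and by
its name, and points at its name if its truth value is true. -/
def Edge : Pt D → Pt D → Prop
  | x, elem d => x.proj val = d
  | elem d, node _ l => ∃ m, l = m ++ [d]
  | name i, node j _ => i = j
  | node i l, node j l' => i = j ∧ ∃ d, l' = l ++ [d]
  | node i l, name j => i = j ∧ tt i l
  | elem _, name _ => False
  | name _, name _ => False

/-- The points used for `n` symbols of the arities `ar`: no more arguments than the arity permits. -/
def Ok (n : ℕ) (ar : ℕ → ℕ) : Pt D → Prop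
  | elem _ => True
  | name i => i < n
  | node i l => i < n ∧ l.length ≤ ar i

theorem finite_ok [Finite D] (n : ℕ) (ar : ℕ → ℕ) : Finite {p : Pt D // p.Ok n ar} := by
  have h₁ : (Set.range (elem : D → Pt D)).Finite := Set.finite_range _
  have h₂ : ((name : ℕ → Pt D) '' Set.Iio n).Finite := (Set.finite_Iio n).image _
  have h₃ : (⋃ i ∈ Set.Iio n, (node i : List D → Pt D) '' {l | l.length ≤ ar i}).Finite :=
    (Set.finite_Iio n).biUnion fun i _ => (List.finite_length_le D (ar i)).image _
  refine ((h₁.union h₂).union h₃).subset fun p hp => ?_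
  cases p with
  | elem d => exact .inl (.inl ⟨d, rfl⟩)
  | name i => exact .inl (.inr ⟨i, hp, rfl⟩)
  | node i l => exact .inr (Set.mem_biUnion (x := i) hp.1 ⟨l, hp.2, rfl⟩)

variable {val tt}

theorem edge_self_iff {x : Pt D} : Edge val tt x x ↔ ∃ d, x = elem d := by
  cases x <;> simp [Edge, proj]

variable {n : ℕ} {ar : ℕ → ℕ}

variable (val tt n ar) in
/-- The relation `Edge` on the finitely many points in use. -/
def EdgeOk (x y : {p : Pt D // p.Ok n ar}) : Prop := Edge val tt x.1 y.1

/-- No quotient is needed here: loops single out the elements, and a node is determined by its name,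
its parent and its last entry. -/
theorem separated_edgeOk : Separated (EdgeOk val tt n ar) := by
  rintro ⟨x, hx⟩ ⟨y, hy⟩ h
  have h₁ (z : Pt D) (hz : z.Ok n ar) : Edge val tt z x ↔ Edge val tt z y := (h ⟨z, hz⟩).1
  have h₂ (z : Pt D) (hz : z.Ok n ar) : Edge val tt x z ↔ Edge val tt y z := (h ⟨z, hz⟩).2
  have hl : Edge val tt x x ↔ Edge val tt y y := (h₂ x hx).trans (h₁ y hy)
  rw [edge_self_iff, edge_self_iff] at hl
  refine Subtype.ext ?_
  change x = y
  cases x with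
  | elem d =>
    obtain ⟨d', rfl⟩ := hl.1 ⟨d, rfl⟩
    have := (h₂ (elem d) trivial).1 rfl
    exact congrArg elem this.symm
  | name i =>
    have := (h₂ (node i []) ⟨hx, Nat.zero_le _⟩).1 rfl
    cases y <;> simp_all [Edge]
  | node i l =>
    cases y with
    | elem d' => simp at hl
    | name j =>
      have := (h₂ (node j []) ⟨hy, Nat.zero_le _⟩).2 rfl
      simp [Edge] at this
    | node j l' =>
      have hij : i = j := (h₁ (name i) hx.1).1 rfl
      subst hij
      have hd (d : D) : (∃ m, l = m ++ [d]) ↔ ∃ m, l' = m ++ [d] := h₁ (elem d) trivial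
      rcases l.eq_nil_or_concat' with rfl | ⟨m, d, rfl⟩
      · rcases l'.eq_nil_or_concat' with rfl | ⟨m, d, rfl⟩
        · rfl
        · simpa using (hd d).2 ⟨m, rfl⟩
      · have hm : m.length ≤ ar i := by
          have := hx.2
          simp only [List.length_append, List.length_singleton] at this
          omega
        obtain ⟨-, d', rfl⟩ := (h₁ (node i m) ⟨hx.1, hm⟩).1 ⟨rfl, d, rfl⟩
        obtain ⟨m', hm'⟩ := (hd d).1 ⟨m, rfl⟩
        simp_all

/-- As long as the arity permits, applying a node to a point appends the element that the point
represents. -/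
theorem step_node {i : ℕ} {l : List D} (h : i < n) (hl : l.length < ar i)
    (a : {p : Pt D // p.Ok n ar}) :
    step (EdgeOk val tt n ar) ⟨node i l, h, hl.le⟩ a =
      ⟨node i (l ++ [a.1.proj val]), h, by simpa using hl⟩ := by
  refine step_eq_of_unique _ ⟨⟨rfl, _, rfl⟩, ?_, ?_, ⟨elem (a.1.proj val), trivial⟩, rfl, rfl,
    l, rfl⟩ ?_
  · simp [EdgeOk, edge_self_iff]
  · simp [EdgeOk, edge_self_iff]
  · rintro ⟨v, hv⟩ ⟨h₁, -, h₂, ⟨y, hy⟩, h₃, h₄, h₅⟩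
    obtain ⟨d, rfl⟩ := edge_self_iff.1 h₃
    cases v with
    | elem d => exact absurd (edge_self_iff.2 ⟨d, rfl⟩) h₂
    | name j => exact h₅.elim
    | node j l' =>
      obtain ⟨rfl, d', rfl⟩ := h₁
      obtain ⟨m, hm⟩ := h₅
      have h₄ : a.1.proj val = d := h₄
      have := List.append_inj_right' hm rfl
      simp_all

theorem foldl_step_node {i : ℕ} {l : List D} (h : i < n)
    (as : List {p : Pt D // p.Ok n ar}) (hl : l.length + as.length ≤ ar i) :
    as.foldl (step (EdgeOk val tt n ar)) ⟨node i l, h, by omega⟩ =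
      ⟨node i (l ++ as.map fun a => a.1.proj val), h, by simpa using hl⟩ := by
  induction as generalizing l with
  | nil => simp
  | cons a as ih =>
    simp only [List.length_cons] at hl
    rw [List.foldl_cons, step_node h (by omega), ih (by simp; omega)]
    simp

theorem mark_node {i : ℕ} {l : List D} (h : i < n) (hl : l.length = ar i) :
    Mark (EdgeOk val tt n ar) ⟨node i l, h, hl.le⟩ ↔ tt i l := by
  constructor
  · rintro ⟨⟨y, hy⟩, h₁, h₂⟩
    cases y with
    | elem d => exact absurd (edge_self_iff.2 ⟨d, rfl⟩) h₂
    | name j => exact h₁.2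
    | node j l' =>
      obtain ⟨rfl, d, rfl⟩ := h₁
      have := hy.2
      simp [hl] at this
  · exact fun ht => ⟨⟨name i, h⟩, ⟨rfl, ht⟩, by simp [EdgeOk, edge_self_iff]⟩

end Pt

section Forward

variable {S : Signature.{u, v}} {D : Type}

/-- The arity of a symbol. -/
def Sym.arity : Sym S → ℕ
  | .inl f => S.funArity f
  | .inr P => S.relArity P

open Classical in
/-- The value of a symbol applied to a list; it is `d₀` unless the symbol is a function symbol and
the list has the right length. -/
noncomputable def Model.listVal (M : Model S D) (d₀ : D) : Sym S → List D → D
  | .inl f, l => if h : ∃ x, List.ofFn x = l then M.funInt f h.choose else d₀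
  | .inr _, _ => d₀

/-- The truth value of a relation symbol applied to a list. -/
def Model.listHolds (M : Model S D) : Sym S → List D → Prop
  | .inl _, _ => False
  | .inr P, l => ∃ x, List.ofFn x = l ∧ M.relInt P x

theorem Model.listVal_ofFn (M : Model S D) (d₀ : D) (f : S.Fun) (x : Fin (S.funArity f) → D) :
    M.listVal d₀ (.inl f) (List.ofFn x) = M.funInt f x := by
  have h : ∃ y : Fin (S.funArity f) → D, List.ofFn y = List.ofFn x := ⟨x, rfl⟩
  rw [Model.listVal, dif_pos h, List.ofFn_injective h.choose_spec]

theorem Model.listHolds_ofFn (M : Model S D) (P : S.Rel) (x : Fin (S.relArity P) → D) :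
    M.listHolds (.inr P) (List.ofFn x) ↔ M.relInt P x :=
  ⟨fun ⟨_, h, h'⟩ => List.ofFn_injective h ▸ h', fun h => ⟨x, rfl, h⟩⟩

/-- A finite model of a formula yields one of its translation, provided that the numbering
numbers the symbols of the formula by positions in a list `L`. -/
theorem fsat_tr_of_fsat (φ : Form S) (L : List (Sym S)) (ix : Sym S → ℕ)
    (hix : ∀ s ∈ φ.syms, L[ix s]? = some s) (h : FSAT S φ) :
    FSAT binarySignature (φ.tr ix 0) := by
  obtain ⟨D, M, ρ, _, -, hφ⟩ := h
  let val : ℕ → List D → D := fun i l => (L[i]?).elim (ρ 0) fun s => M.listVal (ρ 0) s l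
  let tt : ℕ → List D → Prop := fun i l => (L[i]?).elim False fun s => M.listHolds s l
  let ar : ℕ → ℕ := fun i => (L[i]?).elim 0 Sym.arity
  let n := L.length
  let A := {p : Pt D // p.Ok n ar}
  have hlt {s : Sym S} (hs : s ∈ φ.syms) : ix s < n := (List.getElem?_eq_some_iff.1 (hix s hs)).1
  -- Even variables carry the given assignment, odd ones the roots of the trees of the symbols; the
  -- odd variables that number no entry of `L` do not matter.
  let ρ' : ℕ → A := fun k =>
    if k % 2 = 0 then ⟨.elem (ρ (k / 2)), trivial⟩
    else if h : k / 2 < n then ⟨.node (k / 2) [], h, Nat.zero_le _⟩ else ⟨.elem (ρ 0), trivial⟩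
  let C : Sym S → A := fun s => ρ' (2 * (ix s + 0) + 1)
  have hC {s : Sym S} (hs : s ∈ φ.syms) : C s = ⟨.node (ix s) [], hlt hs, Nat.zero_le _⟩ := by
    have h₁ : (2 * (ix s + 0) + 1) % 2 ≠ 0 := by omega
    have h₂ : (2 * (ix s + 0) + 1) / 2 = ix s := by omega
    simp only [C, ρ', if_neg h₁, h₂, dif_pos (hlt hs)]
  refine ⟨A, relModel (Pt.EdgeOk val tt n ar), ρ', Pt.finite_ok n ar, Model.isDecidable _, ?_⟩
  refine (Form.sat_tr (C := C) Pt.separated_edgeOk φ 0 ρ' (fun x => ρ' (2 * x))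
    (fun _ => rfl) fun _ => rfl).2 ?_
  refine (Form.sat_map (N := M) (π := fun a : A => a.1.proj val) (L := φ.syms) ?_ ?_ ?_ φ
    (fun _ h => h) _).2 ?_
  · exact fun d => ⟨⟨.elem d, trivial⟩, rfl⟩
  · intro f hf x
    have hL := hix _ hf
    have har : ar (ix (.inl f)) = S.funArity f := by simp only [ar, hL]; rfl
    simp only [spineModel]
    rw [hC hf, Pt.foldl_step_node (hlt hf) _ (by simp [har])]
    simp only [Pt.proj, val, hL, List.map_ofFn, List.nil_append, Option.elim]
    exact Model.listVal_ofFn _ _ _ _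
  · intro P hP x
    have hL := hix _ hP
    have har : ar (ix (.inr P)) = S.relArity P := by simp only [ar, hL]; rfl
    simp only [spineModel]
    rw [hC hP, Pt.foldl_step_node (hlt hP) _ (by simp [har]), Pt.mark_node (hlt hP) (by simp [har])]
    simp only [tt, hL, List.map_ofFn, List.nil_append, Option.elim]
    exact Model.listHolds_ofFn _ _ _
  · convert hφ using 1
    funext x
    have h₁ : (2 * x) % 2 = 0 := by omega
    have h₂ : (2 * x) / 2 = x := by omega
    simp only [Function.comp, ρ', if_pos h₁, h₂]
    rfl

open Classical in
/-- The number of a symbol: the position of its first occurrence in the formula. It does not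
depend on the codes of symbols. -/
noncomputable def Form.index (φ : Form S) (s : Sym S) : ℕ := φ.syms.findIdx fun t => t = s

theorem Form.index_lt {φ : Form S} {s : Sym S} (hs : s ∈ φ.syms) :
    φ.index s < φ.syms.length :=
  List.findIdx_lt_length.2 ⟨s, hs, by simp⟩

theorem Form.getElem_index {φ : Form S} {s : Sym S} (hs : s ∈ φ.syms) :
    φ.syms[φ.index s]'(Form.index_lt hs) = s := by
  have := List.findIdx_getElem (w := Form.index_lt hs)
  simp only [decide_eq_true_eq] at this
  exact this

/-- The binary formula assigned to a formula. -/
noncomputable def Form.toBinary (φ : Form S) : BForm := φ.tr φ.index 0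

theorem fsat_iff_fsat_toBinary (φ : Form S) : FSAT S φ ↔ FSAT binarySignature φ.toBinary := by
  refine ⟨fsat_tr_of_fsat φ φ.syms _ fun s hs => ?_, fsat_of_fsat_tr φ⟩
  rw [List.getElem?_eq_getElem (Form.index_lt hs), Form.getElem_index hs]

end Forward

/-! ### General recursion for partial recursive functions -/

section Recursion

open Nat.Partrec (Code)
open Encodable

variable {α β : Type} [Primcodable α] [Primcodable β]

/-- The partial function between coded types that a program computes. -/
def run (c : Code) (a : α) : Part β :=
  (c.eval (encode a)).bind fun n => (decode n : Option β)

theorem partrec_run : Partrec₂ (run : Code → α →. β) :=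
  (Nat.Partrec.Code.eval_part.comp Computable.fst (Computable.encode.comp Computable.snd)).bind
    (Computable.decode.comp Computable.snd).ofOption

/-- Recursive definitions: a functional that is partial recursive on programs has
a partial recursive fixed point, by Kleene's second recursion theorem. -/
theorem exists_fixedPoint (F : (α →. β) → α →. β)
    (hF : Partrec₂ fun (c : Code) (a : α) => F (run c) a) :
    ∃ g : α →. β, Partrec g ∧ ∀ a, g a = F g a := by
  have h : Partrec₂ fun (c : Code) (n : ℕ) =>
      ((decode n : Option α) : Part α).bind fun a => (F (run c) a).map encode :=
    (Computable.decode.comp Computable.snd).ofOption.bind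
      ((hF.comp (Computable.fst.comp Computable.fst) Computable.snd).map
        (Computable.encode.comp Computable.snd).to₂)
  obtain ⟨c, hc⟩ := Nat.Partrec.Code.fixed_point₂ h
  refine ⟨run c, partrec_run.comp (Computable.const c) Computable.id, fun a => ?_⟩
  conv_lhs => rw [run, hc]
  simp [Part.bind_map, Part.bind_some_right]

end Recursion

/-! ### Codes of symbols and of binary formulas -/

section Codes

variable {S : Signature.{u, v}}

/-- The coding of the symbols of a signature induced by codings of its function symbols and of its
relation symbols. -/
def symCoding (cF : Coding S.Fun) (cR : Coding S.Rel) : Coding (Sym S)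
  | n, .inl f => ∃ k, n = Nat.pair 0 k ∧ cF k f
  | n, .inr P => ∃ k, n = Nat.pair 1 k ∧ cR k P

theorem discrete_symCoding {cF : Coding S.Fun} {cR : Coding S.Rel} (hF : Discrete cF)
    (hR : Discrete cR) : Discrete (symCoding cF cR) := by
  obtain ⟨e, he, heF⟩ := hF
  obtain ⟨e', he', heR⟩ := hR
  have h₁ : Computable fun p : ℕ × ℕ => p.1.unpair :=
    Computable.unpair.comp Computable.fst
  have h₂ : Computable fun p : ℕ × ℕ => p.2.unpair :=
    Computable.unpair.comp Computable.snd
  have h : Computable fun p : ℕ × ℕ => (p.1.unpair.2, p.2.unpair.2) :=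
    (Computable.snd.comp h₁).pair (Computable.snd.comp h₂)
  refine ⟨fun p => bif p.1.unpair.1 == p.2.unpair.1 then
    (bif p.1.unpair.1 == 0 then e (p.1.unpair.2, p.2.unpair.2)
      else e' (p.1.unpair.2, p.2.unpair.2)) else Part.some false, ?_, ?_⟩
  · exact Partrec.cond
      (Primrec.beq.to_comp.comp (Computable.fst.comp h₁) (Computable.fst.comp h₂))
      (Partrec.cond (Primrec.beq.to_comp.comp (Computable.fst.comp h₁) (Computable.const 0))
        (he.comp h) (he'.comp h)) (Computable.const false).partrec
  · rintro _ _ (f | P) (g | Q) ⟨k, rfl, hk⟩ ⟨l, rfl, hl⟩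
    · simpa using heF k l f g hk hl
    · simp
    · simp
    · simpa using heR k l P Q hk hl

/-- The position of the first entry of `L` that the equality test `e` identifies with `k`. -/
def lookup (e : ℕ × ℕ →. Bool) (L : List ℕ) (k : ℕ) : Part ℕ :=
  Nat.rfind fun i => e (L.getI i, k)

theorem partrec_lookup {e : ℕ × ℕ →. Bool} (he : Partrec e) : Partrec₂ (lookup e) :=
  Partrec.rfind (he.comp ((Primrec.list_getI.to_comp.comp
    (Computable.fst.comp Computable.fst) Computable.snd).pair
      (Computable.snd.comp Computable.fst)))

/-- The position found is the same for all lists of codes of the same symbols and for all codes of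
`x`. -/
theorem mem_lookup {X : Type*} {_ : DecidableEq X} {c : Coding X} {e : ℕ × ℕ →. Bool}
    (he : ∀ m n x y, c m x → c n y → ∃ b ∈ e (m, n), b = true ↔ x = y)
    {L : List ℕ} {xs : List X} (h : List.Forall₂ c L xs) {k : ℕ} {x : X} (hk : c k x)
    (hx : x ∈ xs) : xs.findIdx (fun t => t = x) ∈ lookup e L k := by
  have hlt : xs.findIdx (fun t => t = x) < xs.length := List.findIdx_lt_length.2 ⟨x, hx, by simp⟩
  have hget {i : ℕ} (hi : i < xs.length) : c (L.getI i) xs[i] := by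
    have hi' : i < L.length := h.length_eq ▸ hi
    rw [List.getI_eq_getElem _ hi']
    exact (List.forall₂_iff_get.1 h).2 i hi' hi
  refine Nat.mem_rfind.2 ⟨?_, fun {i} hi => ?_⟩
  · obtain ⟨b, hb, hb'⟩ := he _ _ _ _ (hget hlt) hk
    have := List.findIdx_getElem (w := hlt)
    rwa [hb'.2 (by simpa only [decide_eq_true_eq] using this)] at hb
  · obtain ⟨b, hb, hb'⟩ := he _ _ _ _ (hget (hi.trans hlt)) hk
    have : ¬ xs[i]'(hi.trans hlt) = x := of_decide_eq_false (List.not_of_lt_findIdx hi)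
    cases b with
    | false => exact hb
    | true => exact absurd (hb'.1 rfl) this

/-- The code of a term over the binary signature. -/
def encTerm : Term binarySignature → ℕ
  | .var x => Nat.pair 0 x
  | .app f _ => f.elim

/-- The code of a formula over the binary signature. -/
def enc : BForm → ℕ
  | .bot => Nat.pair 0 0
  | .rel _ ts => Nat.pair 1 (Nat.pair 0 (Encodable.encode (List.ofFn fun i => encTerm (ts i))))
  | .imp φ ψ => Nat.pair 2 (Nat.pair (enc φ) (enc ψ))
  | .and φ ψ => Nat.pair 3 (Nat.pair (enc φ) (enc ψ))
  | .or φ ψ => Nat.pair 4 (Nat.pair (enc φ) (enc ψ))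
  | .all φ => Nat.pair 5 (enc φ)
  | .ex φ => Nat.pair 6 (enc φ)

theorem binaryFormCoding_enc (φ : BForm) : binaryFormCoding (enc φ) φ := by
  unfold binaryFormCoding
  induction φ with
  | bot => exact .bot
  | rel P ts =>
    refine .rel 0 P _ ts rfl fun i => ?_
    cases ts i with
    | var x => exact .var x
    | app f _ => exact f.elim
  | imp φ ψ h₁ h₂ => exact .imp _ _ _ _ h₁ h₂
  | and φ ψ h₁ h₂ => exact .and _ _ _ _ h₁ h₂
  | or φ ψ h₁ h₂ => exact .or _ _ _ _ h₁ h₂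
  | all φ h => exact .all _ _ h
  | ex φ h => exact .ex _ _ h

end Codes

section EncPrimrec

variable {α : Type} [Primcodable α] {f g h : α → ℕ} {φ ψ : α → BForm}

theorem primrec_natPair (hf : Primrec f) (hg : Primrec g) :
    Primrec fun a => Nat.pair (f a) (g a) := Primrec₂.natPair.comp hf hg

theorem primrec_enc_edgeF (hf : Primrec f) (hg : Primrec g) :
    Primrec fun a => enc (edgeF (f a) (g a)) := by
  have h : Primrec fun a => [Nat.pair 0 (f a), Nat.pair 0 (g a)] :=
    Primrec.list_cons.comp (primrec_natPair (Primrec.const 0) hf)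
      (Primrec.list_cons.comp (primrec_natPair (Primrec.const 0) hg) (Primrec.const []))
  exact primrec_natPair (Primrec.const 1) (primrec_natPair (Primrec.const 0)
    (Primrec.encode.comp h))

theorem primrec_enc_imp (hφ : Primrec fun a => enc (φ a)) (hψ : Primrec fun a => enc (ψ a)) :
    Primrec fun a => enc (.imp (φ a) (ψ a)) :=
  primrec_natPair (Primrec.const 2) (primrec_natPair hφ hψ)

theorem primrec_enc_and (hφ : Primrec fun a => enc (φ a)) (hψ : Primrec fun a => enc (ψ a)) :
    Primrec fun a => enc (.and (φ a) (ψ a)) :=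
  primrec_natPair (Primrec.const 3) (primrec_natPair hφ hψ)

theorem primrec_enc_or (hφ : Primrec fun a => enc (φ a)) (hψ : Primrec fun a => enc (ψ a)) :
    Primrec fun a => enc (.or (φ a) (ψ a)) :=
  primrec_natPair (Primrec.const 4) (primrec_natPair hφ hψ)

theorem primrec_enc_all (hφ : Primrec fun a => enc (φ a)) : Primrec fun a => enc (.all (φ a)) :=
  primrec_natPair (Primrec.const 5) hφ

theorem primrec_enc_ex (hφ : Primrec fun a => enc (φ a)) : Primrec fun a => enc (.ex (φ a)) :=
  primrec_natPair (Primrec.const 6) hφ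

theorem primrec_enc_notF (hφ : Primrec fun a => enc (φ a)) : Primrec fun a => enc (notF (φ a)) :=
  primrec_enc_imp hφ (Primrec.const _)

theorem primrec_enc_iffF (hφ : Primrec fun a => enc (φ a)) (hψ : Primrec fun a => enc (ψ a)) :
    Primrec fun a => enc (iffF (φ a) (ψ a)) :=
  primrec_enc_and (primrec_enc_imp hφ hψ) (primrec_enc_imp hψ hφ)

theorem primrec_add_one (hf : Primrec f) : Primrec fun a => f a + 1 := Primrec.succ.comp hf

theorem primrec_enc_eqF (hf : Primrec f) (hg : Primrec g) :
    Primrec fun a => enc (eqF (f a) (g a)) :=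
  have h0 : Primrec fun _ : α => 0 := Primrec.const 0
  have hf := primrec_add_one hf
  have hg := primrec_add_one hg
  primrec_enc_all (primrec_enc_and
    (primrec_enc_iffF (primrec_enc_edgeF h0 hf) (primrec_enc_edgeF h0 hg))
    (primrec_enc_iffF (primrec_enc_edgeF hf h0) (primrec_enc_edgeF hg h0)))

theorem primrec_enc_extF (hf : Primrec f) (hg : Primrec g) (hh : Primrec h) :
    Primrec fun a => enc (extF (f a) (g a) (h a)) :=
  have h0 : Primrec fun _ : α => 0 := Primrec.const 0
  primrec_enc_and (primrec_enc_edgeF hf hh) (primrec_enc_and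
    (primrec_enc_notF (primrec_enc_edgeF hf hf)) (primrec_enc_and
    (primrec_enc_notF (primrec_enc_edgeF hh hh)) (primrec_enc_ex (primrec_enc_and
      (primrec_enc_edgeF h0 h0) (primrec_enc_and (primrec_enc_edgeF (primrec_add_one hg) h0)
        (primrec_enc_edgeF h0 (primrec_add_one hh)))))))

theorem primrec_enc_uniqueExtF (hf : Primrec f) (hg : Primrec g) (hh : Primrec h) :
    Primrec fun a => enc (uniqueExtF (f a) (g a) (h a)) :=
  have h0 : Primrec fun _ : α => 0 := Primrec.const 0
  primrec_enc_and (primrec_enc_extF hf hg hh) (primrec_enc_all (primrec_enc_imp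
    (primrec_enc_extF (primrec_add_one hf) (primrec_add_one hg) h0)
    (primrec_enc_eqF h0 (primrec_add_one hh))))

theorem primrec_enc_stepF (hf : Primrec f) (hg : Primrec g) (hh : Primrec h) :
    Primrec fun a => enc (stepF (f a) (g a) (h a)) :=
  have h0 : Primrec fun _ : α => 0 := Primrec.const 0
  primrec_enc_or (primrec_enc_uniqueExtF hf hg hh) (primrec_enc_and (primrec_enc_eqF hf hh)
    (primrec_enc_notF (primrec_enc_ex
      (primrec_enc_uniqueExtF (primrec_add_one hf) (primrec_add_one hg) h0))))

end EncPrimrec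

/-! ### Algorithms on codes -/

section Algorithms

open Nat.Partrec (Code)

/-- The constructor of the head of a code. -/
def tag (n : ℕ) : ℕ := n.unpair.1

/-- The head symbol of the code of a compound term or of an atom. -/
def headSym (n : ℕ) : ℕ := n.unpair.2.unpair.1

/-- The codes of the arguments of a compound term or of an atom. -/
def args (n : ℕ) : List ℕ := ((Encodable.decode n.unpair.2.unpair.2 : Option (List ℕ))).getD []

theorem primrec_snd_unpair : Primrec fun n : ℕ => n.unpair.2 := Primrec.snd.comp Primrec.unpair

theorem primrec_tag : Primrec tag := Primrec.fst.comp Primrec.unpair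

theorem primrec_headSym : Primrec headSym := primrec_tag.comp primrec_snd_unpair

theorem primrec_args : Primrec args :=
  Primrec.option_getD.comp
    (Primrec.decode.comp (primrec_snd_unpair.comp primrec_snd_unpair)) (Primrec.const [])

@[simp] theorem tag_pair (a b : ℕ) : tag (Nat.pair a b) = a := by simp [tag]

@[simp] theorem headSym_pair (a k b : ℕ) : headSym (Nat.pair a (Nat.pair k b)) = k := by
  simp [headSym]

@[simp] theorem args_pair (a k : ℕ) (l : List ℕ) :
    args (Nat.pair a (Nat.pair k (Encodable.encode l))) = l := by
  simp [args]

/-- The codes of the symbols in a term, given a function that collects them from lists of terms. -/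
def collectTerm (g : List ℕ →. List ℕ) (n : ℕ) : Part (List ℕ) :=
  bif tag n == 0 then Part.some [] else (g (args n)).map (List.cons (Nat.pair 0 (headSym n)))

/-- One step of the recursion that collects the codes of the symbols in a list of terms. -/
def collectTerms (g : List ℕ →. List ℕ) (l : List ℕ) : Part (List ℕ) :=
  bif l.length == 0 then Part.some []
  else (collectTerm g l.headI).bind fun a => (g l.tail).map fun b => a ++ b

/-- One step of the recursion that collects the codes of the symbols in a formula, given a function
`h` that collects them from lists of terms. -/
def collectForm (h : List ℕ →. List ℕ) (g : ℕ →. List ℕ) (n : ℕ) : Part (List ℕ) :=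
  bif tag n == 0 then Part.some []
  else bif tag n == 1 then (h (args n)).map (List.cons (Nat.pair 1 (headSym n)))
  else bif tag n == 5 || tag n == 6 then g n.unpair.2
  else (g n.unpair.2.unpair.1).bind fun a => (g n.unpair.2.unpair.2).map fun b => a ++ b

variable {α : Type} [Primcodable α]

theorem computable_tag_beq {f : α → ℕ} (hf : Computable f) (k : ℕ) :
    Computable fun a => tag (f a) == k :=
  Primrec.beq.to_comp.comp (primrec_tag.to_comp.comp hf) (Computable.const k)

theorem computable_length_beq {f : α → List ℕ} (hf : Computable f) :
    Computable fun a => (f a).length == 0 :=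
  Primrec.beq.to_comp.comp (Computable.list_length.comp hf) (Computable.const 0)

theorem computable_consSym {f : α → ℕ} (hf : Computable f) (k : ℕ) :
    Computable₂ fun (a : α) (l : List ℕ) => Nat.pair k (headSym (f a)) :: l :=
  Computable.list_cons.comp (Primrec₂.natPair.to_comp.comp (Computable.const k)
    (primrec_headSym.to_comp.comp (hf.comp Computable.fst))) Computable.snd

theorem partrec_collectTerm {G : α → List ℕ →. List ℕ} (hG : Partrec₂ G) {f : α → ℕ}
    (hf : Computable f) : Partrec fun a => collectTerm (G a) (f a) :=
  Partrec.cond (computable_tag_beq hf 0) (Computable.const []).partrec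
    ((hG.comp Computable.id (primrec_args.to_comp.comp hf)).map (computable_consSym hf 0))

theorem partrec_collectTerms {G : α → List ℕ →. List ℕ} (hG : Partrec₂ G) {f : α → List ℕ}
    (hf : Computable f) : Partrec fun a => collectTerms (G a) (f a) :=
  Partrec.cond (computable_length_beq hf) (Computable.const []).partrec
    ((partrec_collectTerm hG (Primrec.list_headI.to_comp.comp hf)).bind
      ((hG.comp Computable.fst (Primrec.list_tail.to_comp.comp (hf.comp Computable.fst))).map
        (Computable.list_append.comp (Computable.snd.comp Computable.fst) Computable.snd).to₂).to₂)

theorem partrec_collectForm {h : List ℕ →. List ℕ} (hh : Partrec h) {G : α → ℕ →. List ℕ}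
    (hG : Partrec₂ G) {f : α → ℕ} (hf : Computable f) :
    Partrec fun a => collectForm h (G a) (f a) :=
  have h₁ : Computable fun a => (f a).unpair.2 := primrec_snd_unpair.to_comp.comp hf
  Partrec.cond (computable_tag_beq hf 0) (Computable.const []).partrec
    (Partrec.cond (computable_tag_beq hf 1)
      ((hh.comp (primrec_args.to_comp.comp hf)).map (computable_consSym hf 1))
      (Partrec.cond
        (Primrec.or.to_comp.comp (computable_tag_beq hf 5) (computable_tag_beq hf 6))
        (hG.comp Computable.id h₁)
        ((hG.comp Computable.id (primrec_tag.to_comp.comp h₁)).bind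
          ((hG.comp Computable.fst
              ((primrec_snd_unpair.to_comp.comp h₁).comp Computable.fst)).map
            (Computable.list_append.comp (Computable.snd.comp Computable.fst)
              Computable.snd).to₂).to₂)))

section

variable {S : Signature.{u, v}} {cF : Coding S.Fun} {cR : Coding S.Rel}

theorem forall₂_ofFn {X Y : Type*} {P : X → Y → Prop} {n : ℕ} {f : Fin n → X} {g : Fin n → Y}
    (h : ∀ i, P (f i) (g i)) : List.Forall₂ P (List.ofFn f) (List.ofFn g) := by
  rw [List.forall₂_iff_get]
  exact ⟨by simp, fun i h₁ h₂ => by simpa using h _⟩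

/-- Codes of the symbols of a formula can be computed from a code of the formula. -/
theorem exists_collect (cF : Coding S.Fun) (cR : Coding S.Rel) :
    ∃ g : ℕ →. List ℕ, Partrec g ∧ ∀ n φ, Form.coding cF cR n φ →
      ∃ L ∈ g n, List.Forall₂ (symCoding cF cR) L φ.syms := by
  obtain ⟨h, hh, h_eq⟩ := exists_fixedPoint collectTerms
    (partrec_collectTerms (G := fun (p : Code × List ℕ) => run p.1)
      (partrec_run.comp (Computable.fst.comp Computable.fst) Computable.snd) Computable.snd)
  obtain ⟨g, hg, g_eq⟩ := exists_fixedPoint (collectForm h)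
    (partrec_collectForm hh (G := fun (p : Code × ℕ) => run p.1)
      (partrec_run.comp (Computable.fst.comp Computable.fst) Computable.snd) Computable.snd)
  have hlist {ns : List ℕ} {ss : List (List (Sym S))}
      (H : List.Forall₂ (fun n s => ∃ L ∈ collectTerm h n,
        List.Forall₂ (symCoding cF cR) L s) ns ss) :
      ∃ L ∈ h ns, List.Forall₂ (symCoding cF cR) L ss.flatten := by
    induction H with
    | nil => exact ⟨[], by rw [h_eq]; simp [collectTerms], .nil⟩
    | cons H _ ih =>
      obtain ⟨L, hL, hL'⟩ := H
      obtain ⟨L₂, h₂, h₂'⟩ := ih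
      refine ⟨L ++ L₂, ?_, List.rel_append hL' h₂'⟩
      rw [h_eq]
      simpa [collectTerms] using ⟨L, hL, L₂, h₂, rfl⟩
  have hterm {n : ℕ} {t : Term S} (H : Term.coding cF n t) :
      ∃ L ∈ collectTerm h n, List.Forall₂ (symCoding cF cR) L t.syms := by
    induction H with
    | var x => exact ⟨[], by simp [collectTerm], .nil⟩
    | app k f ns ts hk _ ih =>
      obtain ⟨L, hL, hL'⟩ := hlist (forall₂_ofFn ih)
      exact ⟨Nat.pair 0 k :: L, by simpa [collectTerm] using hL, .cons ⟨k, rfl, hk⟩ hL'⟩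
  refine ⟨g, hg, fun n φ H => ?_⟩
  induction H with
  | bot => exact ⟨[], by rw [g_eq]; simp [collectForm], .nil⟩
  | rel k P ns ts hk H =>
    obtain ⟨L, hL, hL'⟩ := hlist (forall₂_ofFn fun i => hterm (H i))
    refine ⟨Nat.pair 1 k :: L, ?_, .cons ⟨k, rfl, hk⟩ hL'⟩
    rw [g_eq]
    simpa [collectForm] using hL
  | imp m n φ ψ _ _ ih₁ ih₂ | and m n φ ψ _ _ ih₁ ih₂ | or m n φ ψ _ _ ih₁ ih₂ =>
    obtain ⟨L, hL, hL'⟩ := ih₁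
    obtain ⟨L₂, h₂, h₂'⟩ := ih₂
    refine ⟨L ++ L₂, ?_, List.rel_append hL' h₂'⟩
    rw [g_eq]
    simpa [collectForm] using ⟨L, hL, L₂, h₂, rfl⟩
  | all n φ _ ih | ex n φ _ ih =>
    obtain ⟨L, hL, hL'⟩ := ih
    refine ⟨L, ?_, hL'⟩
    rw [g_eq]
    simpa [collectForm] using hL

end

/-- The arguments of the translation of terms: the list of codes of the symbols and the number of
quantifiers above the atom; then the shift and the variables `w`, `v` of `spineF`. -/
abbrev SpineArgs := (List ℕ × ℕ) × ℕ × ℕ × ℕ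

/-- The translation of a term on codes, given a translation `g` of lists of terms. -/
def trTerm (e : ℕ × ℕ →. Bool) (g : SpineArgs × List ℕ →. ℕ) (c : List ℕ × ℕ) (r v n : ℕ) :
    Part ℕ :=
  bif tag n == 0 then Part.some (enc (eqF (2 * n.unpair.2 + r) v))
  else (lookup e c.1 (Nat.pair 0 (headSym n))).bind fun i =>
    g ((c, r, 2 * (i + c.2) + 1 + r, v), args n)

/-- The code of the formula for a list of terms, from the codes for its head and its tail. -/
def consCode (w t u : ℕ) : ℕ :=
  Nat.pair 6 (Nat.pair 6 (Nat.pair 3 (Nat.pair t (Nat.pair 3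
    (Nat.pair (enc (stepF (w + 2) 1 0)) u)))))

/-- One step of the recursion that computes `spineF` on codes. -/
def trSpine (e : ℕ × ℕ →. Bool) (g : SpineArgs × List ℕ →. ℕ) (p : SpineArgs × List ℕ) :
    Part ℕ :=
  bif p.2.length == 0 then Part.some (enc (eqF p.1.2.2.1 p.1.2.2.2))
  else (trTerm e g p.1.1 (p.1.2.1 + 2) 1 p.2.headI).bind fun t =>
    (g ((p.1.1, p.1.2.1 + 2, 0, p.1.2.2.2 + 2), p.2.tail)).map fun u => consCode p.1.2.2.1 t u

/-- One step of the recursion that computes `Form.tr` on codes, given a translation `h` of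
lists of terms. -/
def trForm (e : ℕ × ℕ →. Bool) (h : SpineArgs × List ℕ →. ℕ) (g : (List ℕ × ℕ) × ℕ →. ℕ)
    (p : (List ℕ × ℕ) × ℕ) : Part ℕ :=
  bif tag p.2 == 0 then Part.some (Nat.pair 0 0)
  else bif tag p.2 == 1 then (lookup e p.1.1 (Nat.pair 1 (headSym p.2))).bind fun i =>
    (h ((p.1, 1, 2 * (i + p.1.2) + 1 + 1, 0), args p.2)).map fun u =>
      Nat.pair 6 (Nat.pair 3 (Nat.pair u (enc (markF 0))))
  else bif tag p.2 == 5 || tag p.2 == 6 then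
    (g ((p.1.1, p.1.2 + 1), p.2.unpair.2)).map fun u =>
      Nat.pair (tag p.2) (Nat.pair (tag p.2) u)
  else (g (p.1, p.2.unpair.2.unpair.1)).bind fun a =>
    (g (p.1, p.2.unpair.2.unpair.2)).map fun b => Nat.pair (tag p.2) (Nat.pair a b)

theorem primrec_symVar {i d r : α → ℕ} (hi : Primrec i) (hd : Primrec d) (hr : Primrec r) :
    Primrec fun a => 2 * (i a + d a) + 1 + r a :=
  Primrec.nat_add.comp (Primrec.nat_double_succ.comp (Primrec.nat_add.comp hi hd)) hr

theorem primrec_add_two {f : α → ℕ} (hf : Primrec f) : Primrec fun a => f a + 2 :=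
  Primrec.nat_add.comp hf (Primrec.const 2)

theorem primrec_consCode {w t u : α → ℕ} (hw : Primrec w) (ht : Primrec t) (hu : Primrec u) :
    Primrec fun a => consCode (w a) (t a) (u a) :=
  primrec_natPair (Primrec.const 6) (primrec_natPair (Primrec.const 6)
    (primrec_natPair (Primrec.const 3) (primrec_natPair ht (primrec_natPair (Primrec.const 3)
      (primrec_natPair (primrec_enc_stepF (primrec_add_two hw) (Primrec.const 1)
        (Primrec.const 0)) hu)))))

variable {e : ℕ × ℕ →. Bool} (he : Partrec e)
include he

theorem partrec_trTerm {G : α → SpineArgs × List ℕ →. ℕ} (hG : Partrec₂ G)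
    {c : α → List ℕ × ℕ} {r v n : α → ℕ} (hc : Primrec c) (hr : Primrec r) (hv : Primrec v)
    (hn : Primrec n) : Partrec fun a => trTerm e (G a) (c a) (r a) (v a) (n a) :=
  Partrec.cond (computable_tag_beq hn.to_comp 0)
    (primrec_enc_eqF (Primrec.nat_add.comp
      (Primrec.nat_double.comp (primrec_snd_unpair.comp hn)) hr) hv).to_comp.partrec
    (((partrec_lookup he).comp (Primrec.fst.comp hc).to_comp
      (primrec_natPair (Primrec.const 0) (primrec_headSym.comp hn)).to_comp).bind
      (hG.comp Computable.fst (Primrec.pair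
        (Primrec.pair (hc.comp Primrec.fst) (Primrec.pair (hr.comp Primrec.fst) (Primrec.pair
          (primrec_symVar Primrec.snd (Primrec.snd.comp (hc.comp Primrec.fst))
            (hr.comp Primrec.fst)) (hv.comp Primrec.fst))))
        (primrec_args.comp (hn.comp Primrec.fst))).to_comp).to₂)

theorem partrec_trSpine {G : α → SpineArgs × List ℕ →. ℕ} (hG : Partrec₂ G)
    {p : α → SpineArgs × List ℕ} (hp : Primrec p) : Partrec fun a => trSpine e (G a) (p a) :=
  have hl : Primrec fun a => (p a).2 := Primrec.snd.comp hp
  have hc : Primrec fun a => (p a).1.1 := Primrec.fst.comp (Primrec.fst.comp hp)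
  have hq : Primrec fun a => (p a).1.2 := Primrec.snd.comp (Primrec.fst.comp hp)
  have hr : Primrec fun a => (p a).1.2.1 + 2 := primrec_add_two (Primrec.fst.comp hq)
  have hw : Primrec fun a => (p a).1.2.2.1 := Primrec.fst.comp (Primrec.snd.comp hq)
  have hv : Primrec fun a => (p a).1.2.2.2 := Primrec.snd.comp (Primrec.snd.comp hq)
  Partrec.cond (computable_length_beq hl.to_comp) (primrec_enc_eqF hw hv).to_comp.partrec
    ((partrec_trTerm he hG hc hr (Primrec.const 1) (Primrec.list_headI.comp hl)).bind
      ((hG.comp Computable.fst (Primrec.pair (Primrec.pair (hc.comp Primrec.fst)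
        (Primrec.pair (hr.comp Primrec.fst) (Primrec.pair (Primrec.const 0)
          (primrec_add_two (hv.comp Primrec.fst)))))
        (Primrec.list_tail.comp (hl.comp Primrec.fst))).to_comp).map
        (primrec_consCode (hw.comp (Primrec.fst.comp Primrec.fst))
          (Primrec.snd.comp Primrec.fst) Primrec.snd).to_comp.to₂).to₂)

theorem partrec_trForm {h : SpineArgs × List ℕ →. ℕ} (hh : Partrec h)
    {G : α → (List ℕ × ℕ) × ℕ →. ℕ} (hG : Partrec₂ G) {p : α → (List ℕ × ℕ) × ℕ}
    (hp : Primrec p) : Partrec fun a => trForm e h (G a) (p a) :=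
  have hn : Primrec fun a => (p a).2 := Primrec.snd.comp hp
  have hc : Primrec fun a => (p a).1 := Primrec.fst.comp hp
  have hL : Primrec fun a => (p a).1.1 := Primrec.fst.comp hc
  have hd : Primrec fun a => (p a).1.2 := Primrec.snd.comp hc
  have ht : Primrec fun a => tag (p a).2 := primrec_tag.comp hn
  have hm : Primrec fun a => (p a).2.unpair.2 := primrec_snd_unpair.comp hn
  Partrec.cond (computable_tag_beq hn.to_comp 0) (Computable.const (Nat.pair 0 0)).partrec
    (Partrec.cond (computable_tag_beq hn.to_comp 1)
      (((partrec_lookup he).comp hL.to_comp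
        (primrec_natPair (Primrec.const 1) (primrec_headSym.comp hn)).to_comp).bind
        ((hh.comp (Primrec.pair (Primrec.pair (hc.comp Primrec.fst)
          (Primrec.pair (Primrec.const 1) (Primrec.pair
            (primrec_symVar Primrec.snd (hd.comp Primrec.fst) (Primrec.const 1))
            (Primrec.const 0)))) (primrec_args.comp (hn.comp Primrec.fst))).to_comp).map
          (primrec_natPair (Primrec.const 6) (primrec_natPair (Primrec.const 3)
            (primrec_natPair Primrec.snd (Primrec.const _)))).to_comp.to₂).to₂)
      (Partrec.cond (Primrec.or.to_comp.comp (computable_tag_beq hn.to_comp 5)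
          (computable_tag_beq hn.to_comp 6))
        ((hG.comp Computable.id (Primrec.pair (Primrec.pair hL (primrec_add_one hd))
          hm).to_comp).map
          (primrec_natPair (ht.comp Primrec.fst) (primrec_natPair (ht.comp Primrec.fst)
            Primrec.snd)).to_comp.to₂)
        ((hG.comp Computable.id (Primrec.pair hc (primrec_tag.comp hm)).to_comp).bind
          ((hG.comp Computable.fst ((Primrec.pair hc
              (primrec_snd_unpair.comp hm)).comp Primrec.fst).to_comp).map
            (primrec_natPair (ht.comp (Primrec.fst.comp Primrec.fst))
              (primrec_natPair (Primrec.snd.comp Primrec.fst)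
                Primrec.snd)).to_comp.to₂).to₂)))

/-- The translation is computable, given codes of the symbols for the numbering. -/
theorem exists_translate {S : Signature.{u, v}} {cF : Coding S.Fun} {cR : Coding S.Rel} :
    ∃ g : (List ℕ × ℕ) × ℕ →. ℕ, Partrec g ∧ ∀ (L : List ℕ) (ix : Sym S → ℕ) (n : ℕ)
      (φ : Form S) (d : ℕ), Form.coding cF cR n φ →
      (∀ k s, symCoding cF cR k s → s ∈ φ.syms → ix s ∈ lookup e L k) →
      enc (φ.tr ix d) ∈ g ((L, d), n) := by
  obtain ⟨h, hh, h_eq⟩ := exists_fixedPoint (trSpine e)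
    (partrec_trSpine he (G := fun (p : Code × SpineArgs × List ℕ) => run p.1)
      (partrec_run.comp (Computable.fst.comp Computable.fst) Computable.snd) Primrec.snd)
  obtain ⟨g, hg, g_eq⟩ := exists_fixedPoint (trForm e h)
    (partrec_trForm he hh (G := fun (p : Code × (List ℕ × ℕ) × ℕ) => run p.1)
      (partrec_run.comp (Computable.fst.comp Computable.fst) Computable.snd) Primrec.snd)
  refine ⟨g, hg, fun L ix n φ d H hs => ?_⟩
  have hlist (d : ℕ) {ns : List ℕ} {Ts : List (ℕ → ℕ → BForm)}
      (H : List.Forall₂ (fun n T => ∀ r v, enc (T r v) ∈ trTerm e h (L, d) r v n) ns Ts)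
      (r w v : ℕ) : enc (spineF Ts r w v) ∈ h (((L, d), r, w, v), ns) := by
    induction H generalizing r w v with
    | nil => rw [h_eq]; simp [trSpine, spineF]
    | cons H _ ih =>
      rw [h_eq]
      simpa [trSpine] using ⟨_, H (r + 2) 1, _, ih (r + 2) 0 (v + 2), rfl⟩
  have hterm (d : ℕ) {n : ℕ} {t : Term S} (H : Term.coding cF n t)
      (hs : ∀ k s, symCoding cF cR k s → s ∈ t.syms → ix s ∈ lookup e L k) (r v : ℕ) :
      enc (t.tr ix d r v) ∈ trTerm e h (L, d) r v n := by
    induction H generalizing r v with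
    | var x => simp [trTerm, Term.tr]
    | app k f ns ts hk _ ih =>
      have h₁ := hs (Nat.pair 0 k) (.inl f) ⟨k, rfl, hk⟩ (by simp [Term.syms])
      have h₂ := hlist d (forall₂_ofFn fun i => ih i fun k s hk hs' => hs k s hk (by
        simp only [Term.syms, List.mem_cons, List.mem_flatten, List.mem_ofFn']
        exact .inr ⟨_, ⟨i, rfl⟩, hs'⟩)) r (2 * (ix (.inl f) + d) + 1 + r) v
      simpa [trTerm, Term.tr] using ⟨_, h₁, h₂⟩
  induction H generalizing d with
  | bot => rw [g_eq]; simp [trForm, Form.tr, enc]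
  | rel k P ns ts hk H =>
    have h₁ := hs (Nat.pair 1 k) (.inr P) ⟨k, rfl, hk⟩ (by simp [Form.syms])
    have h₂ := hlist d (forall₂_ofFn fun i => hterm d (H i) fun k s hk hs' => hs k s hk (by
      simp only [Form.syms, List.mem_cons, List.mem_flatten, List.mem_ofFn']
      exact .inr ⟨_, ⟨i, rfl⟩, hs'⟩)) 1 (2 * (ix (.inr P) + d) + 1 + 1) 0
    rw [g_eq]
    simp only [trForm, tag_pair, headSym_pair, args_pair, Nat.unpair_pair, Nat.reduceBEq,
      Bool.or_self, cond_false, cond_true]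
    exact Part.mem_bind h₁ (Part.mem_map _ h₂)
  | imp m n φ ψ _ _ ih₁ ih₂ | and m n φ ψ _ _ ih₁ ih₂ | or m n φ ψ _ _ ih₁ ih₂ =>
    simp only [Form.syms, List.mem_append] at hs
    have h₁ := ih₁ d fun k s hk h => hs k s hk (.inl h)
    have h₂ := ih₂ d fun k s hk h => hs k s hk (.inr h)
    rw [g_eq]
    simp only [trForm, tag_pair, headSym_pair, Nat.unpair_pair, Nat.reduceBEq,
      Bool.or_self, cond_false]
    exact Part.mem_bind h₁ (Part.mem_map _ h₂)
  | all n φ _ ih | ex n φ _ ih =>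
    have h₁ := ih (d + 1) hs
    rw [g_eq]
    simpa [trForm, Form.tr, enc] using h₁

end Algorithms

/-- Two passes over the code: the first collects the codes of the symbols, the second translates. -/
theorem computableFun_toBinary {S : Signature.{u, v}} {cF : Coding S.Fun} {cR : Coding S.Rel}
    (hF : Discrete cF) (hR : Discrete cR) :
    ComputableFun (Form.coding cF cR) binaryFormCoding Form.toBinary := by
  obtain ⟨e, he, he'⟩ := discrete_symCoding hF hR
  obtain ⟨g, hg, hg'⟩ := exists_collect cF cR
  obtain ⟨h, hh, hh'⟩ := exists_translate he (cF := cF) (cR := cR)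
  refine ⟨fun n => (g n).bind fun L => h ((L, 0), n), ?_, fun n φ hn => ?_⟩
  · exact hg.bind (hh.comp ((Computable.snd.pair (Computable.const 0)).pair Computable.fst)).to₂
  · obtain ⟨L, hL, hL'⟩ := hg' n φ hn
    refine ⟨enc φ.toBinary, Part.mem_bind_iff.2 ⟨L, hL, ?_⟩, binaryFormCoding_enc _⟩
    exact hh' L φ.index n φ 0 hn fun k s hk hs => mem_lookup he' hL' hk hs

end FinSat

theorem theorem4p12 (S : FinSat.Signature.{u, v})
    (cF : FinSat.Coding S.Fun) (cR : FinSat.Coding S.Rel)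
    (hF : FinSat.Discrete cF) (hR : FinSat.Discrete cR) :
    FinSat.Reduces (FinSat.Form.coding cF cR) FinSat.binaryFormCoding
      (FinSat.FSAT S) (FinSat.FSAT FinSat.binarySignature) :=
  ⟨FinSat.Form.toBinary, FinSat.computableFun_toBinary hF hR, FinSat.fsat_iff_fsat_toBinary⟩
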